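/- There is an absolute constant $c>0$ such that the following holds. Let $G$ be an abelian group with more than one element (possibly infinite), let $A,B\subset G$ be finite, non-empty subsets, and let $K_1,K_2$ be real numbers such that \[ |A+B|\le K_1|A| \quad\text{and}\quad |A+B|\le K_2|B| . \] Then $A+B$ contains an arithmetic progression of length at least \[ \tfrac12\exp\left(c\left(\frac{\log|A|}{K_1\log 2K_2}\right)^{1/4}\right). \] Here $A+B=\{a+b : a\in A,\ b\in B\}$, and a set $P\subset G$ is called an arithmetic progression of length $k$ if $P=\{a,a+d,\dots,a+(k-1)d\}$ for some $a\in G$ and some non-zero $d\in G$; the listed terms need not be distinct, so a progression may be degenerate if $d$ has small order. -/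

import Mathlib

open scoped Pointwise

/-- `P` is an arithmetic progression of length `k` in the abelian group `G`: it can be written as
`{a, a + d, …, a + (k - 1) d}` for some `a` and some non-zero step `d`. As usual in a general
abelian group, the listed terms are not required to be distinct. -/
def IsArithProgOfLength {G : Type*} [AddCommGroup G] (P : Set G) (k : ℕ) : Prop :=
  ∃ a d : G, d ≠ 0 ∧ P = {x | ∃ i : ℕ, i < k ∧ x = a + i • d}

/-! Let `f = repDensity A B`, the convolution of `1_A` with the uniform measure on `B`; it is
positive exactly on `A + B`. Sampling `m` points of `B` approximates `f` in `ℓ^{2l}` with relative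
error of order `θ`. Pigeonholing over the translates `t + b` gives a large `T ⊆ A` for which all
`f(· - t)` are close to one function, so `T - T`, and hence `2T - 2T`, consists of almost-periods
(`exists_large_subset_translates_close`).

By Plünnecke and Ruzsa covering, few translates of `T - T` cover `2T - 2T`. Repeated doubling and
pigeonholing then gives `d ≠ 0` with `2^i • d ∈ 2T - 2T` for all `i ≤ l`
(`exists_ne_zero_two_pow_nsmul_mem`). Binary expansion makes every `j • d`, `j < 2^l`, an
almost-period at the cost of a factor `l` only.

If no progression `x + j • d` stayed in `A + B`, each `f(x)` would equal some `|f(x + j • d) -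
f(x)|`. Summing `2l`-th powers loses a factor `2^l`, harmless for the exponent `2l`, and contradicts
the smallness of the error when `θ = 1/(16l)`. The sizes work once `log |A|` exceeds a constant
times `l^4 K₁ log 2K₂`, whence the exponent `1/4`. -/

theorem sum_abs_add_pow_le {ι : Type*} (W : Finset ι) (a b : ι → ℝ) {p : ℕ} (hp : 1 ≤ p)
    {r s : ℝ} (hr : 0 ≤ r) (hs : 0 ≤ s) (ha : ∑ x ∈ W, |a x| ^ p ≤ r ^ p)
    (hb : ∑ x ∈ W, |b x| ^ p ≤ s ^ p) : ∑ x ∈ W, |a x + b x| ^ p ≤ (r + s) ^ p := by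
  have hp0 : p ≠ 0 := by omega
  have h := Real.Lp_add_le W a b (p := (p : ℝ)) (by exact_mod_cast hp)
  simp only [Real.rpow_natCast, one_div] at h
  have key : ∀ (c : ι → ℝ) (u : ℝ), 0 ≤ u → ∑ x ∈ W, |c x| ^ p ≤ u ^ p →
      (∑ x ∈ W, |c x| ^ p) ^ ((p : ℝ)⁻¹) ≤ u := by
    intro c u hu hc
    calc _ ≤ (u ^ p) ^ ((p : ℝ)⁻¹) :=
          Real.rpow_le_rpow (by positivity) hc (by positivity)
      _ = u := Real.pow_rpow_inv_natCast hu hp0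
  have h2 := h.trans (add_le_add (key a r hr ha) (key b s hs hb))
  calc ∑ x ∈ W, |a x + b x| ^ p = ((∑ x ∈ W, |a x + b x| ^ p) ^ ((p : ℝ)⁻¹)) ^ p :=
        (Real.rpow_inv_natCast_pow (by positivity) hp0).symm
    _ ≤ (r + s) ^ p := pow_le_pow_left₀ (by positivity) h2 p

/-! ### Moments of sampled frequencies. -/

theorem pow_div_factorial_le_cosh_sub_one (y : ℝ) {r : ℕ} (hr : 1 ≤ r) :
    y ^ (2 * r) / (2 * r).factorial ≤ Real.cosh y - 1 := by
  have h := sum_le_hasSum ({0, r} : Finset ℕ)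
    (fun n _ => by rw [pow_mul]; positivity) (Real.hasSum_cosh y)
  rw [Finset.sum_pair (by omega)] at h
  simp at h
  linarith

/-- On `{0, 1}` the function `exp (s g)` is affine in `g`, so its mean depends only on `q`; then
`e^s - 1 - s ≤ s²`. -/
theorem sum_exp_mul_sub_mean_le {β : Type*} (B : Finset β) (g : β → ℝ)
    (hg : ∀ b, g b = 0 ∨ g b = 1) {q : ℝ} (hq : ∑ b ∈ B, g b = B.card * q) (hq0 : 0 ≤ q)
    {s : ℝ} (hs : |s| ≤ 1) :
    ∑ b ∈ B, Real.exp (s * (g b - q)) ≤ B.card * Real.exp (q * s ^ 2) := by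
  have h1 : ∀ b, Real.exp (s * (g b - q)) =
      (1 + g b * (Real.exp s - 1)) * Real.exp (-(s * q)) := by
    intro b
    rcases hg b with h | h <;> simp [h, ← Real.exp_add]
    ring
  have h2 := (abs_le.1 (Real.abs_exp_sub_one_sub_id_le hs)).2
  calc ∑ b ∈ B, Real.exp (s * (g b - q))
      = B.card * (q * (Real.exp s - 1) + 1) * Real.exp (-(s * q)) := by
        simp_rw [h1]
        rw [← Finset.sum_mul, Finset.sum_add_distrib, ← Finset.sum_mul, hq]
        simp only [Finset.sum_const, nsmul_eq_mul, mul_one]; ring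
    _ ≤ B.card * Real.exp (q * (Real.exp s - 1)) * Real.exp (-(s * q)) := by
        gcongr; exact Real.add_one_le_exp _
    _ = B.card * Real.exp (q * (Real.exp s - 1 - s)) := by
        rw [mul_assoc, ← Real.exp_add]; congr 2; ring
    _ ≤ _ := by gcongr

theorem sum_exp_sum_sub_mean_le {β : Type*} (B : Finset β) (g : β → ℝ)
    (hg : ∀ b, g b = 0 ∨ g b = 1) {q : ℝ} (hq : ∑ b ∈ B, g b = B.card * q) (hq0 : 0 ≤ q)
    {s : ℝ} (hs : |s| ≤ 1) (m : ℕ) :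
    ∑ b ∈ Fintype.piFinset (fun _ : Fin m => B), Real.exp (s * ∑ i, (g (b i) - q)) ≤
      (B.card : ℝ) ^ m * Real.exp (m * q * s ^ 2) := by
  calc _ = ∏ _i : Fin m, ∑ b ∈ B, Real.exp (s * (g b - q)) := by
        rw [Finset.prod_univ_sum]
        simp_rw [Finset.mul_sum, Real.exp_sum]
    _ = (∑ b ∈ B, Real.exp (s * (g b - q))) ^ m := by simp
    _ ≤ (B.card * Real.exp (q * s ^ 2)) ^ m := by
        gcongr; exact sum_exp_mul_sub_mean_le B g hg hq hq0 hs
    _ = _ := by rw [mul_pow, ← Real.exp_nat_mul]; congr 2; ring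

/-- One even Taylor term of `cosh - 1` bounds the moment. Dropping the constant term leaves `exp V -
1`, which is of order `V` for small `V`; this keeps a factor `q` at rarely represented points. -/
theorem sum_pow_le_of_sum_exp_le {Ω : Type*} (S : Finset Ω) (Y : Ω → ℝ) {s V : ℝ} {r : ℕ}
    (hr : 1 ≤ r) (hs : 0 < s) (h1 : ∑ b ∈ S, Real.exp (s * Y b) ≤ S.card * Real.exp V)
    (h2 : ∑ b ∈ S, Real.exp (-s * Y b) ≤ S.card * Real.exp V) :
    ∑ b ∈ S, |Y b| ^ (2 * r) ≤
      S.card * (((2 * r : ℝ) ^ 2 / s ^ 2) ^ r * (Real.exp V - 1)) := by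
  have h3 : ∑ b ∈ S, (Real.cosh (s * Y b) - 1) ≤ S.card * (Real.exp V - 1) := by
    simp_rw [Real.cosh_eq]
    rw [Finset.sum_sub_distrib, ← Finset.sum_div, Finset.sum_add_distrib]
    simp only [neg_mul] at h2
    simp
    linarith
  have h4 : ∀ b ∈ S, |Y b| ^ (2 * r) ≤
      ((2 * r : ℝ) ^ 2 / s ^ 2) ^ r * (Real.cosh (s * Y b) - 1) := by
    intro b _
    have h := pow_div_factorial_le_cosh_sub_one (s * Y b) hr
    have hf : ((2 * r).factorial : ℝ) ≤ (2 * r : ℝ) ^ (2 * r) := by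
      exact_mod_cast Nat.factorial_le_pow (2 * r)
    have hc : 0 ≤ Real.cosh (s * Y b) - 1 := by linarith [Real.one_le_cosh (s * Y b)]
    rw [div_le_iff₀ (by positivity), mul_pow] at h
    rw [div_pow, ← pow_mul, ← pow_mul, div_mul_eq_mul_div, le_div_iff₀ (by positivity),
      (even_two_mul r).pow_abs]
    nlinarith [mul_le_mul_of_nonneg_left hf hc]
  calc _ ≤ ∑ b ∈ S, ((2 * r : ℝ) ^ 2 / s ^ 2) ^ r * (Real.cosh (s * Y b) - 1) :=
        Finset.sum_le_sum h4
    _ = ((2 * r : ℝ) ^ 2 / s ^ 2) ^ r * ∑ b ∈ S, (Real.cosh (s * Y b) - 1) := by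
        rw [Finset.mul_sum]
    _ ≤ ((2 * r : ℝ) ^ 2 / s ^ 2) ^ r * (S.card * (Real.exp V - 1)) := by gcongr
    _ = _ := by ring

theorem exp_two_mul_natCast_le (r : ℕ) : Real.exp (2 * r) ≤ 8 ^ r := by
  have h : Real.exp 2 ≤ 8 := by
    have := Real.exp_one_lt_d9
    have h0 := Real.exp_pos 1
    rw [show (2 : ℝ) = 1 + 1 by norm_num, Real.exp_add]
    nlinarith
  rw [mul_comm, Real.exp_nat_mul]
  exact pow_le_pow_left₀ (Real.exp_pos _).le h r

/-- Centred moments of a sampled frequency: for `m ≥ 32 r K / θ²` samples, the `2r`-th moment of the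
deviation is at most `θ^{2r} (q^{2r} + q K^{1 - 2r})`, up to scaling. -/
theorem sum_abs_sum_sub_mean_pow_le {β : Type*} (B : Finset β) (g : β → ℝ)
    (hg : ∀ b, g b = 0 ∨ g b = 1) {q : ℝ} (hq : ∑ b ∈ B, g b = B.card * q) (hq0 : 0 < q)
    {r m : ℕ} (hr : 1 ≤ r) {K θ : ℝ} (hK : 1 ≤ K) (hθ : 0 < θ) (hθ1 : θ ≤ 1)
    (hm : 32 * r * K ≤ θ ^ 2 * m) :
    ∑ b ∈ Fintype.piFinset (fun _ : Fin m => B), |∑ i, (g (b i) - q)| ^ (2 * r) ≤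
      (B.card : ℝ) ^ m * ((θ ^ 2 * m ^ 2) ^ r * (q ^ (2 * r) + q * K / (K ^ 2) ^ r)) := by
  have hr' : (1 : ℝ) ≤ r := by exact_mod_cast hr
  have hK0 : 0 < K := by linarith
  have hm2 : 32 * r * K ≤ m := by
    have : θ ^ 2 ≤ 1 := pow_le_one₀ hθ.le hθ1
    have h0 : (0 : ℝ) ≤ m := by positivity
    nlinarith
  have hm0 : (0 : ℝ) < m := lt_of_lt_of_le (by positivity) hm2
  have hcard : ((Fintype.piFinset (fun _ : Fin m => B)).card : ℝ) = (B.card : ℝ) ^ m := by simp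
  have main : ∀ z : ℝ, 0 < z → z ≤ 1 →
      ∑ b ∈ Fintype.piFinset (fun _ : Fin m => B), |∑ i, (g (b i) - q)| ^ (2 * r) ≤
      (B.card : ℝ) ^ m * (((2 * r : ℝ) ^ 2 / z) ^ r * (Real.exp (m * q * z) - 1)) := by
    intro z hz hz1
    have hs : 0 < √z := Real.sqrt_pos.2 hz
    have hs1 : |√z| ≤ 1 := by rw [abs_of_pos hs]; exact Real.sqrt_le_one.2 hz1
    have h := sum_pow_le_of_sum_exp_le (Fintype.piFinset (fun _ : Fin m => B))
      (fun b => ∑ i, (g (b i) - q)) (V := m * q * z) hr hs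
      (by rw [hcard]
          simpa [Real.sq_sqrt hz.le] using sum_exp_sum_sub_mean_le B g hg hq hq0.le hs1 m)
      (by rw [hcard]
          simpa [Real.sq_sqrt hz.le] using
            sum_exp_sum_sub_mean_le B g hg hq hq0.le (s := -√z) (by rwa [abs_neg]) m)
    rwa [hcard, Real.sq_sqrt hz.le] at h
  -- Here `z` is the squared exponential parameter. For `q ≥ 1/K` take `z = 2r/(mq)`, so that the
  -- exponent is `2r`. For smaller `q`, freeze `z` at its value for `q = 1/K`, which keeps `z ≤ 1`.
  rcases le_total (1 / K) q with hcase | hcase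
  · have hKq : 1 ≤ q * K := by rwa [div_le_iff₀ hK0] at hcase
    have hz1 : 2 * r / (m * q) ≤ 1 := by
      rw [div_le_one (by positivity)]; nlinarith
    refine (main (2 * r / (m * q)) (by positivity) hz1).trans
      (mul_le_mul_of_nonneg_left ?_ (by positivity))
    have e1 : (2 * r : ℝ) ^ 2 / (2 * r / (m * q)) = 2 * r * m * q := by field_simp
    have e2 : m * q * (2 * r / (m * q)) = (2 * r : ℝ) := by field_simp
    rw [e1, e2]
    calc (2 * r * m * q) ^ r * (Real.exp (2 * r) - 1)
        ≤ (2 * r * m * q) ^ r * 8 ^ r := by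
          gcongr; linarith [exp_two_mul_natCast_le r]
      _ = (16 * r * m * q) ^ r := by rw [← mul_pow]; congr 1; ring
      _ ≤ (θ ^ 2 * m ^ 2 * q ^ 2) ^ r := by
          refine pow_le_pow_left₀ (by positivity) ?_ r
          have : 16 * r ≤ θ ^ 2 * m * q := by nlinarith
          nlinarith [mul_le_mul_of_nonneg_left this (mul_pos hm0 hq0).le]
      _ = (θ ^ 2 * m ^ 2) ^ r * q ^ (2 * r) := by rw [mul_pow _ (q ^ 2), pow_mul]
      _ ≤ _ := by
          gcongr
          have : 0 ≤ q * K / (K ^ 2) ^ r := by positivity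
          linarith
  · have hKq : K * q ≤ 1 := by rwa [le_div_iff₀ hK0, mul_comm] at hcase
    have hz1 : 2 * r * K / m ≤ 1 := by
      rw [div_le_one (by positivity)]; nlinarith
    refine (main (2 * r * K / m) (by positivity) hz1).trans
      (mul_le_mul_of_nonneg_left ?_ (by positivity))
    have e1 : (2 * r : ℝ) ^ 2 / (2 * r * K / m) = 2 * r * m / K := by field_simp
    have e2 : m * q * (2 * r * K / m) = 2 * r * (K * q) := by field_simp
    -- This is `e^x - 1 ≤ x e^x`, which retains the factor `q`.
    have hexp : Real.exp (2 * r * (K * q)) - 1 ≤ 2 * r * (K * q) * 8 ^ r := by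
      have h1 := Real.add_one_le_exp (-(2 * r * (K * q)))
      have h2 : Real.exp (2 * r * (K * q)) * Real.exp (-(2 * r * (K * q))) = 1 := by
        rw [← Real.exp_add]; simp
      have h3 : Real.exp (2 * r * (K * q)) ≤ 8 ^ r := by
        refine le_trans (Real.exp_le_exp.2 ?_) (exp_two_mul_natCast_le r)
        nlinarith
      have h4 : 0 ≤ 2 * r * (K * q) := by positivity
      nlinarith [Real.exp_pos (2 * r * (K * q))]
    have h2r : (2 * r : ℝ) ≤ 2 ^ r := by
      have : ∀ n : ℕ, 1 ≤ n → 2 * n ≤ 2 ^ n := by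
        intro n hn
        induction n, hn using Nat.le_induction with
        | base => norm_num
        | succ n hn ih => rw [pow_succ]; omega
      exact_mod_cast this r hr
    rw [e1, e2]
    calc (2 * r * m / K) ^ r * (Real.exp (2 * r * (K * q)) - 1)
        ≤ (2 * r * m / K) ^ r * (2 ^ r * (K * q) * 8 ^ r) := by
          gcongr
          refine hexp.trans ?_
          gcongr
      _ = (32 * r * K * m / K ^ 2) ^ r * (q * K) := by
          have : (32 * r * K * m / K ^ 2) = (2 * r * m / K) * 2 * 8 := by field_simp; norm_num
          rw [this, mul_pow, mul_pow]; ring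
      _ ≤ (θ ^ 2 * m ^ 2 / K ^ 2) ^ r * (q * K) := by
          refine mul_le_mul_of_nonneg_right (pow_le_pow_left₀ (by positivity)
            (div_le_div_of_nonneg_right ?_ (by positivity)) r) (by positivity)
          nlinarith [mul_le_mul_of_nonneg_right hm hm0.le]
      _ = (θ ^ 2 * m ^ 2) ^ r * (q * K / (K ^ 2) ^ r) := by rw [div_pow]; ring
      _ ≤ _ := by
          gcongr
          have : 0 ≤ q ^ (2 * r) := by positivity
          linarith

/-- The proportion of `b ∈ B` with `x ∈ A + b`. -/
noncomputable def repDensity {G : Type*} [AddCommGroup G] [DecidableEq G] (A B : Finset G)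
    (x : G) : ℝ :=
  (∑ b ∈ B, if x - b ∈ A then (1 : ℝ) else 0) / B.card

/-! ### Almost-periodicity of the convolution. -/

section repDensity
variable {G : Type*} [AddCommGroup G] [DecidableEq G] {A B : Finset G}

theorem repDensity_nonneg (A B : Finset G) (x : G) : 0 ≤ repDensity A B x := by
  unfold repDensity
  have : ∀ b ∈ B, (0 : ℝ) ≤ if x - b ∈ A then (1 : ℝ) else 0 := by
    intro b _; split_ifs <;> norm_num
  exact div_nonneg (Finset.sum_nonneg this) (by positivity)

theorem repDensity_eq_zero_of_notMem {x : G} (hx : x ∉ A + B) : repDensity A B x = 0 := by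
  unfold repDensity
  rw [Finset.sum_eq_zero, zero_div]
  intro b hb
  rw [if_neg]
  intro h
  exact hx (Finset.mem_add.2 ⟨x - b, h, b, hb, by abel⟩)

theorem repDensity_pos_of_mem {x : G} (hx : x ∈ A + B) : 0 < repDensity A B x := by
  obtain ⟨a, ha, b, hb, rfl⟩ := Finset.mem_add.1 hx
  unfold repDensity
  have hB : (0 : ℝ) < B.card := by exact_mod_cast Finset.card_pos.2 ⟨b, hb⟩
  refine div_pos (Finset.sum_pos' (fun c _ => ?_) ⟨b, hb, by simp [ha]⟩) hB
  split_ifs <;> norm_num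

theorem sum_repDensity (hB : B.Nonempty) : ∑ x ∈ A + B, repDensity A B x = A.card := by
  have hB0 : (B.card : ℝ) ≠ 0 := by exact_mod_cast hB.card_pos.ne'
  unfold repDensity
  rw [← Finset.sum_div, Finset.sum_comm, div_eq_iff hB0]
  have : ∀ b ∈ B, ∑ x ∈ A + B, (if x - b ∈ A then (1 : ℝ) else 0) = A.card := by
    intro b hb
    rw [← Finset.sum_filter, Finset.sum_const, nsmul_eq_mul, mul_one]
    congr 1
    refine Finset.card_nbij' (fun x => x - b) (fun a => a + b) ?_ ?_ ?_ ?_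
    · intro x hx; simpa using (Finset.mem_filter.1 hx).2
    · intro a ha; simp at ha; simpa [ha] using Finset.add_mem_add ha hb
    · intro x _; simp
    · intro x _; simp
  rw [Finset.sum_congr rfl this, Finset.sum_const, nsmul_eq_mul, mul_comm]

/-- Power mean inequality: mass `|A|` is spread over at most `K|A|` points. It absorbs the `q K^(1 -
2r)` error terms, which sum to the left-hand side. -/
theorem le_sum_repDensity_pow (hA : A.Nonempty) (hB : B.Nonempty) {K : ℝ} (hK : 1 ≤ K)
    (hAB : ((A + B).card : ℝ) ≤ K * A.card) {r : ℕ} (hr : 1 ≤ r) :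
    A.card * (K / (K ^ 2) ^ r) ≤ ∑ x ∈ A + B, repDensity A B x ^ (2 * r) := by
  have hK0 : 0 < K := by linarith
  have hA0 : (0 : ℝ) < A.card := by exact_mod_cast hA.card_pos
  have hAB0 : (0 : ℝ) < (A + B).card := by exact_mod_cast (hA.add hB).card_pos
  obtain ⟨n, hn⟩ : ∃ n, 2 * r = n + 1 := ⟨2 * r - 1, by omega⟩
  have h := pow_sum_div_card_le_sum_pow (s := A + B) (f := repDensity A B)
    (fun x _ => repDensity_nonneg A B x) n
  rw [sum_repDensity hB] at h
  rw [← pow_mul, hn]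
  refine le_trans ?_ h
  calc (A.card : ℝ) * (K / K ^ (n + 1)) = (A.card : ℝ) ^ (n + 1) / (K * A.card) ^ n := by
        rw [mul_pow]; field_simp; ring
    _ ≤ _ := by gcongr

theorem sum_sum_abs_sub_repDensity_pow_le (hA : A.Nonempty) (hB : B.Nonempty) {K θ : ℝ}
    (hK : 1 ≤ K) (hAB : ((A + B).card : ℝ) ≤ K * A.card) {r m : ℕ} (hr : 1 ≤ r)
    (hθ : 0 < θ) (hθ1 : θ ≤ 1) (hm : 32 * r * K ≤ θ ^ 2 * m) :
    ∑ b ∈ Fintype.piFinset (fun _ : Fin m => B), ∑ x ∈ A + B,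
        |∑ i, ((if x - b i ∈ A then (1 : ℝ) else 0) - repDensity A B x)| ^ (2 * r) ≤
      (B.card : ℝ) ^ m *
        ((θ ^ 2 * m ^ 2) ^ r * (2 * ∑ x ∈ A + B, repDensity A B x ^ (2 * r))) := by
  have hB0 : (B.card : ℝ) ≠ 0 := by exact_mod_cast hB.card_pos.ne'
  have hK0 : 0 < K := by linarith
  rw [Finset.sum_comm]
  calc _ ≤ ∑ x ∈ A + B, (B.card : ℝ) ^ m * ((θ ^ 2 * m ^ 2) ^ r *
        (repDensity A B x ^ (2 * r) + repDensity A B x * K / (K ^ 2) ^ r)) := by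
        refine Finset.sum_le_sum fun x hx => ?_
        refine sum_abs_sum_sub_mean_pow_le B (fun b => if x - b ∈ A then (1 : ℝ) else 0) ?_ ?_
          (repDensity_pos_of_mem hx) hr hK hθ hθ1 hm
        · intro b; split_ifs <;> simp
        · unfold repDensity; field_simp
    _ = (B.card : ℝ) ^ m * ((θ ^ 2 * m ^ 2) ^ r *
        (∑ x ∈ A + B, repDensity A B x ^ (2 * r) + A.card * (K / (K ^ 2) ^ r))) := by
        rw [← Finset.mul_sum, ← Finset.mul_sum, Finset.sum_add_distrib,
          ← sum_repDensity (A := A) hB, Finset.sum_mul]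
        simp_rw [mul_div_assoc]
    _ ≤ _ := by
        gcongr
        linarith [le_sum_repDensity_pow hA hB hK hAB hr]

/-- `L^p`-almost-periodicity: on a large subset of `A`, the translates of `repDensity A B` are
all close to one function. -/
theorem exists_large_subset_translates_close (hA : A.Nonempty) (hB : B.Nonempty) {K₁ K₂ θ : ℝ}
    (hK : 1 ≤ K₁) (hAB₁ : ((A + B).card : ℝ) ≤ K₁ * A.card)
    (hAB₂ : ((A + B).card : ℝ) ≤ K₂ * B.card) {r m : ℕ} (hr : 1 ≤ r)
    (hθ : 0 < θ) (hθ1 : θ ≤ 1) (hm : 32 * r * K₁ ≤ θ ^ 2 * m) :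
    ∃ T ⊆ A, (A.card : ℝ) ≤ 2 * K₂ ^ m * T.card ∧ ∃ h : G → ℝ, ∀ t ∈ T, ∀ W : Finset G,
      ∑ y ∈ W, |h y - repDensity A B (y - t)| ^ (2 * r) ≤
        (θ ^ 2) ^ r * (4 * ∑ x ∈ A + B, repDensity A B x ^ (2 * r)) := by
  classical
  have hB0 : (0 : ℝ) < B.card := by exact_mod_cast hB.card_pos
  have hA0 : (0 : ℝ) < A.card := by exact_mod_cast hA.card_pos
  have hAB0 : (0 : ℝ) < (A + B).card := by exact_mod_cast (hA.add hB).card_pos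
  have hr' : (1 : ℝ) ≤ r := by exact_mod_cast hr
  have hm0 : (0 : ℝ) < m := by
    have : 0 < θ ^ 2 * m := lt_of_lt_of_le (by positivity) hm
    exact (pos_iff_pos_of_mul_pos this).1 (by positivity)
  set S := ∑ x ∈ A + B, repDensity A B x ^ (2 * r) with hS
  have hS0 : 0 < S := Finset.sum_pos (fun x hx => pow_pos (repDensity_pos_of_mem hx) _)
    (hA.add hB)
  set E : (Fin m → G) → ℝ := fun b => ∑ x ∈ A + B,
    |∑ i, ((if x - b i ∈ A then (1 : ℝ) else 0) - repDensity A B x)| ^ (2 * r) with hE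
  have hE0 : ∀ b, 0 ≤ E b := fun b => Finset.sum_nonneg fun x _ => by positivity
  set Q := (θ ^ 2 * (m : ℝ) ^ 2) ^ r * (4 * S) with hQ
  have hQ0 : 0 < Q := by positivity
  set Ω := Fintype.piFinset (fun _ : Fin m => B) with hΩ
  have hΩc : (Ω.card : ℝ) = (B.card : ℝ) ^ m := by simp [hΩ]
  have hsum : ∑ b ∈ Ω, E b ≤ (B.card : ℝ) ^ m * (Q / 2) := by
    refine (sum_sum_abs_sub_repDensity_pow_le hA hB hK hAB₁ hr hθ hθ1 hm).trans (le_of_eq ?_)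
    rw [hQ]; ring
  set good := Ω.filter (fun b => E b ≤ Q) with hgood
  -- Markov's inequality: `Q` is twice the bound on the average of `E`.
  have hgc : (B.card : ℝ) ^ m / 2 ≤ good.card := by
    have h1 : ((Ω.filter (fun b => ¬ E b ≤ Q)).card : ℝ) * Q ≤ ∑ b ∈ Ω, E b := by
      rw [← nsmul_eq_mul]
      refine (Finset.card_nsmul_le_sum _ E Q fun b hb => ?_).trans
        (Finset.sum_le_sum_of_subset_of_nonneg (Finset.filter_subset _ _) fun b _ _ => hE0 b)
      exact (not_le.1 (Finset.mem_filter.1 hb).2).le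
    have h2 : (good.card : ℝ) + (Ω.filter (fun b => ¬ E b ≤ Q)).card = (B.card : ℝ) ^ m := by
      rw [← hΩc]
      exact_mod_cast Finset.card_filter_add_card_filter_not (s := Ω) (fun b => E b ≤ Q)
    have h3 : ((Ω.filter (fun b => ¬ E b ≤ Q)).card : ℝ) ≤ (B.card : ℝ) ^ m / 2 := by
      refine le_of_mul_le_mul_right ?_ hQ0
      linarith
    linarith
  -- Translating a good sample by `t ∈ A` lands in `(A + B)^m`, so some `c` equals `t + b` for many
  -- pairs. Each such pair is determined by `t`, and the sampled average translated by `t` depends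
  -- on `c` alone.
  obtain ⟨c, -, hc⟩ := Finset.exists_le_card_fiber_of_nsmul_le_card_of_maps_to
    (s := A ×ˢ good) (t := Fintype.piFinset (fun _ : Fin m => A + B))
    (f := fun z i => z.1 + z.2 i) (b := (A.card : ℝ) * good.card / (A + B).card ^ m)
    (by
      intro z hz
      rw [Finset.mem_product] at hz
      have := Fintype.mem_piFinset.1 (Finset.mem_filter.1 hz.2).1
      exact Fintype.mem_piFinset.2 fun i => Finset.add_mem_add hz.1 (this i))
    (by
      obtain ⟨x, hx⟩ := hA.add hB
      exact ⟨fun _ => x, Fintype.mem_piFinset.2 fun _ => hx⟩)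
    (by
      rw [nsmul_eq_mul, Finset.card_product]
      simp only [Fintype.card_piFinset_const, Nat.cast_pow, Nat.cast_mul]
      rw [mul_div_cancel₀ _ (by positivity)])
  refine ⟨A.filter (fun t => (fun i => c i - t) ∈ good), Finset.filter_subset _ _, ?_,
    fun y => (∑ i, if y - c i ∈ A then (1 : ℝ) else 0) / m, ?_⟩
  · have h1 : ((A ×ˢ good).filter (fun z => (fun i => z.1 + z.2 i) = c)).card ≤
        (A.filter (fun t => (fun i => c i - t) ∈ good)).card := by
      refine Finset.card_le_card_of_injOn Prod.fst ?_ ?_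
      · rintro ⟨t, b⟩ hz
        simp only [Finset.coe_filter, Finset.mem_product, Set.mem_ofPred_eq] at hz ⊢
        obtain ⟨⟨ht, hb⟩, rfl⟩ := hz
        simpa [ht] using hb
      · rintro ⟨t, b⟩ hz ⟨t', b'⟩ hz' rfl
        simp only [Finset.coe_filter, Finset.mem_product, Set.mem_ofPred_eq] at hz hz'
        have := hz.2.trans hz'.2.symm
        refine Prod.ext rfl (funext fun i => ?_)
        simpa using congrFun this i
    have h2 := hc.trans (Nat.cast_le.2 h1)
    rw [div_le_iff₀ (by positivity)] at h2
    set τ : ℝ := ((A.filter (fun t => (fun i => c i - t) ∈ good)).card : ℝ) with hτ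
    have hτ0 : 0 ≤ τ := by positivity
    have h3 : ((A + B).card : ℝ) ^ m ≤ K₂ ^ m * (B.card : ℝ) ^ m := by
      rw [← mul_pow]; gcongr
    have hBm : 0 < (B.card : ℝ) ^ m := by positivity
    refine le_of_mul_le_mul_right (a := (B.card : ℝ) ^ m / 2) ?_ (by positivity)
    calc (A.card : ℝ) * ((B.card : ℝ) ^ m / 2) ≤ A.card * good.card := by gcongr
      _ ≤ τ * (A + B).card ^ m := h2
      _ ≤ τ * (K₂ ^ m * (B.card : ℝ) ^ m) := by gcongr
      _ = _ := by ring
  · intro t ht W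
    obtain ⟨-, hb⟩ := Finset.mem_filter.1 ht
    obtain ⟨hbΩ, hbE⟩ := Finset.mem_filter.1 hb
    set b : Fin m → G := fun i => c i - t with hbdef
    have hbB := Fintype.mem_piFinset.1 hbΩ
    set F : G → ℝ := fun x =>
      |∑ i, ((if x - b i ∈ A then (1 : ℝ) else 0) - repDensity A B x)| ^ (2 * r) with hF
    have hF0 : ∀ x ∉ A + B, F x = 0 := by
      intro x hx
      have h0 : ∀ i, ¬ (x - b i ∈ A) := fun i h =>
        hx (Finset.mem_add.2 ⟨x - b i, h, b i, hbB i, by abel⟩)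
      have : 2 * r ≠ 0 := by omega
      simp [hF, h0, repDensity_eq_zero_of_notMem hx, this]
    have hterm : ∀ y, |(∑ i, if y - c i ∈ A then (1 : ℝ) else 0) / m -
        repDensity A B (y - t)| ^ (2 * r) = F (y - t) / (m ^ 2) ^ r := by
      intro y
      have hsub : ∀ i, y - t - b i = y - c i := fun i => by simp [hbdef]
      simp only [hF, hsub]
      rw [Finset.sum_sub_distrib, Finset.sum_const, Finset.card_univ, Fintype.card_fin,
        nsmul_eq_mul, ← pow_mul, ← abs_of_pos (pow_pos hm0 (2 * r)), abs_pow (m : ℝ), ← div_pow,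
        ← abs_div]
      congr 2
      field_simp
    calc _ = (∑ y ∈ W, F (y - t)) / (m ^ 2) ^ r := by
          rw [Finset.sum_div]; exact Finset.sum_congr rfl fun y _ => hterm y
      _ = (∑ x ∈ W.image (fun y => y - t), F x) / (m ^ 2) ^ r := by
          rw [Finset.sum_image (fun _ _ _ _ h => sub_left_injective h)]
      _ ≤ (∑ x ∈ A + B, F x) / (m ^ 2) ^ r := by
          refine div_le_div_of_nonneg_right ?_ (by positivity)
          rw [← Finset.sum_filter_add_sum_filter_not (W.image (fun y => y - t)) (· ∈ A + B),
            Finset.sum_eq_zero (s := Finset.filter (fun x => ¬ x ∈ A + B) _)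
              (fun x hx => hF0 x (Finset.mem_filter.1 hx).2), add_zero]
          exact Finset.sum_le_sum_of_subset_of_nonneg
            (fun x hx => (Finset.mem_filter.1 hx).2) fun x _ _ => by positivity
      _ ≤ Q / (m ^ 2) ^ r := by gcongr
      _ = _ := by rw [hQ, mul_pow]; field_simp

end repDensity

/-- `u` is a `δ`-almost-period of `f` in `ℓ^p`. -/
def IsAlmostPeriod {G : Type*} [AddCommGroup G] (f : G → ℝ) (p : ℕ) (u : G) (δ : ℝ) : Prop :=
  ∀ W : Finset G, ∑ x ∈ W, |f (x + u) - f x| ^ p ≤ δ ^ p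

/-! ### Calculus of almost-periods. -/

namespace IsAlmostPeriod
variable {G : Type*} [AddCommGroup G] {f : G → ℝ} {p : ℕ} {u v : G} {δ ε : ℝ}

theorem zero (hp : 1 ≤ p) (hδ : 0 ≤ δ) : IsAlmostPeriod f p 0 δ := by
  intro W
  have : p ≠ 0 := by omega
  simpa [this] using pow_nonneg hδ p

theorem mono (h : IsAlmostPeriod f p u δ) (hδ : 0 ≤ δ) (hε : δ ≤ ε) : IsAlmostPeriod f p u ε :=
  fun W => (h W).trans (pow_le_pow_left₀ hδ hε p)

theorem add (hp : 1 ≤ p) (hδ : 0 ≤ δ) (hε : 0 ≤ ε) (hu : IsAlmostPeriod f p u δ)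
    (hv : IsAlmostPeriod f p v ε) : IsAlmostPeriod f p (u + v) (δ + ε) := by
  classical
  intro W
  have h1 := hu (W.image (· + v))
  rw [Finset.sum_image (fun _ _ _ _ h => add_left_injective v h)] at h1
  have h := sum_abs_add_pow_le W _ _ hp hδ hε h1 (hv W)
  refine le_trans (le_of_eq (Finset.sum_congr rfl fun x _ => ?_)) h
  rw [show x + (u + v) = x + v + u by abel]
  congr 2
  ring

theorem neg (hu : IsAlmostPeriod f p u δ) : IsAlmostPeriod f p (-u) δ := by
  classical
  intro W
  have h1 := hu (W.image (· + -u))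
  rw [Finset.sum_image (fun _ _ _ _ h => add_left_injective (-u) h)] at h1
  refine le_trans (le_of_eq (Finset.sum_congr rfl fun x _ => ?_)) h1
  rw [abs_sub_comm, neg_add_cancel_right]

/-- Binary expansion: `j • d` is a sum of at most `l` terms `2^i • d`, so the error grows by `l`
instead of `2^l`. -/
theorem nsmul_of_two_pow_nsmul {d : G} (hp : 1 ≤ p) (hδ : 0 ≤ δ) {l : ℕ}
    (h : ∀ i < l, IsAlmostPeriod f p (2 ^ i • d) δ) {j : ℕ} (hj : j < 2 ^ l) :
    IsAlmostPeriod f p (j • d) (l * δ) := by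
  induction l generalizing j with
  | zero =>
    have : j = 0 := by simpa using hj
    subst this
    simpa using zero hp le_rfl
  | succ l ih =>
    have ih' := @ih fun i hi => h i (by omega)
    have hl : (0 : ℝ) ≤ l * δ := by positivity
    push_cast
    rw [add_mul, one_mul]
    rcases lt_or_ge j (2 ^ l) with hlt | hge
    · exact (ih' hlt).mono hl (by linarith)
    · have h1 : j - 2 ^ l < 2 ^ l := by rw [pow_succ] at hj; omega
      have := add hp hl hδ (ih' h1) (h l (by omega))
      rwa [← add_nsmul, Nat.sub_add_cancel hge] at this

theorem sub_of_close (hp : 1 ≤ p) (hδ : 0 ≤ δ) {h : G → ℝ} {t s : G}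
    (ht : ∀ W : Finset G, ∑ y ∈ W, |h y - f (y - t)| ^ p ≤ δ ^ p)
    (hs : ∀ W : Finset G, ∑ y ∈ W, |h y - f (y - s)| ^ p ≤ δ ^ p) :
    IsAlmostPeriod f p (t - s) (δ + δ) := by
  classical
  intro W
  have h1 := ht (W.image (· + t))
  have h2 := hs (W.image (· + t))
  rw [Finset.sum_image (fun _ _ _ _ h => add_left_injective t h)] at h1 h2
  simp_rw [abs_sub_comm (h _)] at h2
  have := sum_abs_add_pow_le W _ _ hp hδ hδ h2 h1
  refine le_trans (le_of_eq (Finset.sum_congr rfl fun x _ => ?_)) this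
  rw [add_sub_cancel_right, add_sub_assoc]
  congr 2
  ring

end IsAlmostPeriod

/-! ### Dyadic multiples in `2T - 2T` and progressions. -/

section
variable {G : Type*} [AddCommGroup G] [DecidableEq G]

/-- Doubling an element of `T - T` lands in `2T - 2T`, and a translate by some `z ∈ F` returns it to
`T - T`. Keeping the most popular `z` costs a factor `K` per doubling. -/
theorem exists_subset_two_pow_nsmul_sub_mem {T F : Finset G} {K : ℝ} (hT : T.Nonempty)
    (hF : T + T - (T + T) ⊆ F + (T - T)) (hFK : (F.card : ℝ) ≤ K) (l : ℕ) :
    ∃ T' ⊆ T, (T.card : ℝ) ≤ K ^ l * T'.card ∧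
      ∃ y : ℕ → G, ∀ i ≤ l, ∀ t ∈ T', 2 ^ i • t - y i ∈ T - T := by
  have hTc : (0 : ℝ) < T.card := by exact_mod_cast hT.card_pos
  induction l with
  | zero =>
    obtain ⟨t₀, ht₀⟩ := hT
    refine ⟨T, subset_rfl, by simp, fun _ => t₀, fun i hi t ht => ?_⟩
    obtain rfl : i = 0 := by omega
    simpa using Finset.sub_mem_sub ht ht₀
  | succ l ih =>
    obtain ⟨T', hT', hc, y, hy⟩ := ih
    have hmem : ∀ t ∈ T', ∃ z ∈ F, 2 ^ (l + 1) • t - 2 • y l - z ∈ T - T := by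
      intro t ht
      obtain ⟨a, ha, b, hb, hab⟩ := Finset.mem_sub.1 (hy l le_rfl t ht)
      have h1 : 2 ^ (l + 1) • t - 2 • y l ∈ T + T - (T + T) := by
        refine Finset.mem_sub.2 ⟨a + a, Finset.add_mem_add ha ha, b + b,
          Finset.add_mem_add hb hb, ?_⟩
        rw [pow_succ', mul_nsmul', ← nsmul_sub, ← hab]
        abel
      obtain ⟨z, hz, w, hw, hzw⟩ := Finset.mem_add.1 (hF h1)
      exact ⟨z, hz, by rw [← hzw, add_sub_cancel_left]; exact hw⟩
    choose! φ hφ hφ' using hmem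
    have hT'c : (0 : ℝ) < T'.card := by
      rcases T'.eq_empty_or_nonempty with h | h
      · simp [h] at hc; exact absurd hc hT.ne_empty
      · exact_mod_cast h.card_pos
    have hT'n : T'.Nonempty := Finset.card_pos.1 (by exact_mod_cast hT'c)
    have hFn : F.Nonempty := ⟨_, hφ _ hT'n.choose_spec⟩
    have hFc : (0 : ℝ) < F.card := by exact_mod_cast hFn.card_pos
    obtain ⟨z, -, hz⟩ := Finset.exists_le_card_fiber_of_nsmul_le_card_of_maps_to
      (s := T') (t := F) (f := φ) (b := (T'.card : ℝ) / F.card) hφ hFn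
      (by rw [nsmul_eq_mul, mul_div_cancel₀ _ hFc.ne'])
    refine ⟨T'.filter (fun t => φ t = z), (Finset.filter_subset _ _).trans hT', ?_,
      Function.update y (l + 1) (2 • y l + z), ?_⟩
    · rw [div_le_iff₀ hFc] at hz
      have hK : 0 < K := hFc.trans_le hFK
      calc (T.card : ℝ) ≤ K ^ l * T'.card := hc
        _ ≤ K ^ l * ((T'.filter (fun t => φ t = z)).card * F.card) := by gcongr
        _ ≤ K ^ l * ((T'.filter (fun t => φ t = z)).card * K) := by gcongr
        _ = _ := by ring
    · intro i hi t ht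
      obtain ⟨htT, rfl⟩ := Finset.mem_filter.1 ht
      rcases Nat.lt_or_ge l i with h | h
      · obtain rfl : i = l + 1 := by omega
        rw [Function.update_self, ← sub_sub]
        exact hφ' t htT
      · rw [Function.update_of_ne (by omega)]
        exact hy i h t htT

/-- Two distinct points of the refined set share all base points `y i`, which cancel in their
difference `d`. -/
theorem exists_ne_zero_two_pow_nsmul_mem {T F : Finset G} {K : ℝ} (hT : T.Nonempty)
    (hF : T + T - (T + T) ⊆ F + (T - T)) (hFK : (F.card : ℝ) ≤ K) (l : ℕ)
    (hK : K ^ l < T.card) : ∃ d : G, d ≠ 0 ∧ ∀ i ≤ l, 2 ^ i • d ∈ T - T - (T - T) := by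
  obtain ⟨T', -, hc, y, hy⟩ := exists_subset_two_pow_nsmul_sub_mem hT hF hFK l
  have hK0 : 0 ≤ K := le_trans (by positivity) hFK
  have h1 : 1 < T'.card := by
    by_contra! h
    have : (T'.card : ℝ) ≤ 1 := by exact_mod_cast h
    have := mul_le_mul_of_nonneg_left this (pow_nonneg hK0 l)
    linarith
  obtain ⟨s, hs, t, ht, hst⟩ := Finset.one_lt_card.1 h1
  refine ⟨s - t, sub_ne_zero.2 hst, fun i hi => ?_⟩
  have := Finset.sub_mem_sub (hy i hi s hs) (hy i hi t ht)
  rwa [sub_sub_sub_cancel_right, ← nsmul_sub] at this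

theorem card_sumset_three_sub_two_le {A B T : Finset G} (hB : B.Nonempty) {K : ℝ}
    (hAB : ((A + B).card : ℝ) ≤ K * B.card) (hT : T ⊆ A) :
    ((T + T - (T + T) + T).card : ℝ) ≤ K ^ 5 * B.card := by
  have hB0 : (0 : ℝ) < B.card := by exact_mod_cast hB.card_pos
  have hsub : T + T - (T + T) + T ⊆ 3 • A - 2 • A := by
    rw [show T + T - (T + T) + T = T + T + T - (T + T) from sub_add_eq_add_sub _ _ _, succ_nsmul A 2, two_nsmul]
    gcongr
  have h := Finset.pluennecke_ruzsa_inequality_nsmul_sub_nsmul_add hB A 3 2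
  rw [add_comm B A] at h
  have h' : ((3 • A - 2 • A).card : ℝ) ≤ ((A + B).card / B.card : ℝ) ^ (3 + 2) * B.card := by
    simpa using (NNRat.cast_le (K := ℝ)).2 h
  calc ((T + T - (T + T) + T).card : ℝ) ≤ (3 • A - 2 • A).card := by
        exact_mod_cast Finset.card_le_card hsub
    _ ≤ _ := h'
    _ ≤ K ^ 5 * B.card := by
        gcongr
        rwa [div_le_iff₀ hB0]

theorem exists_two_pow_progression {A B : Finset G} (hA : A.Nonempty) (hB : B.Nonempty)
    {K₁ K₂ : ℝ} (hK₁ : 1 ≤ K₁) (hK₂ : 1 ≤ K₂) (hAB₁ : ((A + B).card : ℝ) ≤ K₁ * A.card)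
    (hAB₂ : ((A + B).card : ℝ) ≤ K₂ * B.card) {l m : ℕ} (hl : 1 ≤ l)
    (hm : 8192 * l ^ 3 * K₁ ≤ m)
    (hlarge : 2 * K₂ ^ m * (K₂ ^ 5 * K₁ * (2 * K₂ ^ m)) ^ l < A.card) :
    ∃ a d : G, d ≠ 0 ∧ ∀ j < 2 ^ l, a + j • d ∈ A + B := by
  have hl' : (1 : ℝ) ≤ l := by exact_mod_cast hl
  have hK₁0 : 0 < K₁ := by linarith
  have hK₂0 : 0 < K₂ := by linarith
  have hA0 : (0 : ℝ) < A.card := by exact_mod_cast hA.card_pos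
  have hp : 1 ≤ 2 * l := by omega
  -- The accumulated error is `4lδ` with `δ^(2l) = θ^(2l) · 4S`; this choice makes `4lθ = 1/4`, and
  -- `2^l · (1/4)^(2l) = (1/8)^l` beats the factor `4`.
  set θ : ℝ := 1 / (16 * l) with hθdef
  have hθ : 0 < θ := by positivity
  have hθ1 : θ ≤ 1 := by rw [hθdef, div_le_one (by positivity)]; linarith
  obtain ⟨T, hTA, hTc, h, hh⟩ := exists_large_subset_translates_close (r := l) (m := m) (θ := θ)
    hA hB hK₁ hAB₁ hAB₂ hl hθ hθ1
    (by rw [hθdef, div_pow, one_pow, div_mul_eq_mul_div, one_mul, le_div_iff₀ (by positivity)]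
        linarith)
  set S := ∑ x ∈ A + B, repDensity A B x ^ (2 * l) with hS
  have hS0 : 0 < S := Finset.sum_pos (fun x hx => pow_pos (repDensity_pos_of_mem hx) _)
    (hA.add hB)
  obtain ⟨δ, hδ0, hδ⟩ : ∃ δ : ℝ, 0 ≤ δ ∧ δ ^ (2 * l) = (θ ^ 2) ^ l * (4 * S) :=
    ⟨((θ ^ 2) ^ l * (4 * S)) ^ (((2 * l : ℕ) : ℝ)⁻¹), by positivity,
      Real.rpow_inv_natCast_pow (by positivity) (by omega)⟩
  simp_rw [← hδ] at hh
  have hT0 : (0 : ℝ) < T.card :=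
    (pos_iff_pos_of_mul_pos (hA0.trans_le hTc)).1 (by positivity)
  have hTn : T.Nonempty := Finset.card_pos.1 (by exact_mod_cast hT0)
  have hper : ∀ u ∈ T - T - (T - T),
      IsAlmostPeriod (repDensity A B) (2 * l) u (4 * δ) := by
    have h1 : ∀ u ∈ T - T, IsAlmostPeriod (repDensity A B) (2 * l) u (δ + δ) := by
      intro u hu
      obtain ⟨t, ht, s, hs, rfl⟩ := Finset.mem_sub.1 hu
      exact .sub_of_close hp hδ0 (hh t ht) (hh s hs)
    intro u hu
    obtain ⟨v, hv, w, hw, rfl⟩ := Finset.mem_sub.1 hu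
    rw [sub_eq_add_neg, show 4 * δ = (δ + δ) + (δ + δ) by ring]
    exact .add hp (by positivity) (by positivity) (h1 v hv) (h1 w hw).neg
  obtain ⟨F, -, hFc, hF⟩ := Finset.ruzsa_covering_add (A := T + T - (T + T)) (B := T)
    (K := K₂ ^ 5 * K₁ * (2 * K₂ ^ m)) hTn (by
      have hBA : (B.card : ℝ) ≤ K₁ * A.card :=
        le_trans (by exact_mod_cast Finset.card_le_card_add_left hA) hAB₁
      calc _ ≤ K₂ ^ 5 * B.card := card_sumset_three_sub_two_le hB hAB₂ hTA
        _ ≤ K₂ ^ 5 * (K₁ * (2 * K₂ ^ m * T.card)) := by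
          gcongr
          exact hBA.trans (by gcongr)
        _ = _ := by ring)
  obtain ⟨d, hd, hdT⟩ := exists_ne_zero_two_pow_nsmul_mem hTn hF hFc l (by
    refine lt_of_mul_lt_mul_left (hlarge.trans_le hTc) (by positivity))
  have hj : ∀ j < 2 ^ l, IsAlmostPeriod (repDensity A B) (2 * l) (j • d) (l * (4 * δ)) :=
    fun j hj => .nsmul_of_two_pow_nsmul hp (by positivity) (fun i hi => hper _ (hdT i hi.le)) hj
  by_contra! hcon
  -- Each `x` has an escaping `j` with `f(x + j • d) = 0`; bounding its term by the sum over all `j`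
  -- allows the order of summation to be swapped.
  have hbound : S ≤ 2 ^ l * (l * (4 * δ)) ^ (2 * l) := by
    calc S ≤ ∑ x ∈ A + B, ∑ j ∈ Finset.range (2 ^ l),
          |repDensity A B (x + j • d) - repDensity A B x| ^ (2 * l) := by
          refine Finset.sum_le_sum fun x _ => ?_
          obtain ⟨j, hjl, hjx⟩ := hcon x d hd
          refine le_trans (le_of_eq ?_) (Finset.single_le_sum
            (f := fun j : ℕ => |repDensity A B (x + j • d) - repDensity A B x| ^ (2 * l))
            (fun _ _ => by positivity) (Finset.mem_range.2 hjl))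
          rw [repDensity_eq_zero_of_notMem hjx, zero_sub, abs_neg,
            abs_of_nonneg (repDensity_nonneg A B x)]
      _ = ∑ j ∈ Finset.range (2 ^ l), ∑ x ∈ A + B,
          |repDensity A B (x + j • d) - repDensity A B x| ^ (2 * l) := Finset.sum_comm
      _ ≤ ∑ _j ∈ Finset.range (2 ^ l), (l * (4 * δ)) ^ (2 * l) :=
          Finset.sum_le_sum fun j hjl => hj j (Finset.mem_range.1 hjl) _
      _ = _ := by simp
  have heq : (2 : ℝ) ^ l * (l * (4 * δ)) ^ (2 * l) = (1 / 8) ^ l * (4 * S) := by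
    rw [show (l : ℝ) * (4 * δ) = l * 4 * δ by ring, mul_pow _ δ, hδ, pow_mul, ← mul_assoc,
      ← mul_assoc, ← mul_pow, ← mul_pow, hθdef]
    congr 2
    field_simp
    norm_num
  have h8 : (1 / 8 : ℝ) ^ l ≤ 1 / 8 := by
    simpa using pow_le_pow_of_le_one (by norm_num : (0 : ℝ) ≤ 1 / 8) (by norm_num) hl
  rw [heq] at hbound
  nlinarith

end

/-! ### Choice of parameters. -/

theorem exists_two_pow_progression_of_log_le {G : Type*} [AddCommGroup G] [DecidableEq G]
    {A B : Finset G} (hA : A.Nonempty) (hB : B.Nonempty)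
    {K₁ K₂ : ℝ} (hK₁ : 1 ≤ K₁) (hK₂ : 1 ≤ K₂) (hAB₁ : ((A + B).card : ℝ) ≤ K₁ * A.card)
    (hAB₂ : ((A + B).card : ℝ) ≤ K₂ * B.card) {l : ℕ} (hl : 1 ≤ l)
    (hlog : 20000 * (l : ℝ) ^ 4 * (K₁ * Real.log (2 * K₂)) ≤ Real.log A.card) :
    ∃ a d : G, d ≠ 0 ∧ ∀ j < 2 ^ l, a + j • d ∈ A + B := by
  have hl' : (1 : ℝ) ≤ l := by exact_mod_cast hl
  have hK₁0 : 0 < K₁ := by linarith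
  have hK₂0 : 0 < K₂ := by linarith
  have hA0 : (0 : ℝ) < A.card := by exact_mod_cast hA.card_pos
  set m := ⌈8192 * (l : ℝ) ^ 3 * K₁⌉₊ with hmdef
  refine exists_two_pow_progression hA hB hK₁ hK₂ hAB₁ hAB₂ hl (Nat.le_ceil _) ?_
  have hlogM : Real.log (2 * K₂ ^ m) = Real.log 2 + m * Real.log K₂ := by
    rw [Real.log_mul (by positivity) (by positivity), Real.log_pow]
  rw [← hmdef, ← Real.log_lt_log_iff (by positivity) hA0,
    Real.log_mul (x := 2 * K₂ ^ m) (by positivity) (by positivity), Real.log_pow,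
    Real.log_mul (x := K₂ ^ 5 * K₁) (by positivity) (by positivity),
    Real.log_mul (x := K₂ ^ 5) (by positivity) (by positivity), hlogM, Real.log_pow]
  refine lt_of_lt_of_le ?_ hlog
  set Λ := Real.log (2 * K₂) with hΛ
  have hΛ2 : Real.log 2 ≤ Λ := Real.log_le_log (by norm_num) (by linarith)
  have hΛK : Real.log K₂ ≤ Λ := Real.log_le_log hK₂0 (by linarith)
  have hΛ1 : 1 / 2 ≤ Λ := by linarith [Real.log_two_gt_d9]
  have hlogK₁ : Real.log K₁ ≤ 2 * (K₁ * Λ) := by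
    have := Real.log_le_sub_one_of_pos hK₁0
    nlinarith
  have h1 : (1 : ℝ) ≤ l ^ 3 := one_le_pow₀ hl'
  have h2 : (l : ℝ) ≤ l ^ 4 := by nlinarith
  have h3 : (l : ℝ) ^ 3 ≤ l ^ 4 := pow_le_pow_right₀ hl' (by norm_num)
  -- The ceiling adds less than `1 ≤ l³ K₁`.
  have hm : (m : ℝ) ≤ 8193 * (l : ℝ) ^ 3 * K₁ := by
    have := Nat.ceil_lt_add_one (show 0 ≤ 8192 * (l : ℝ) ^ 3 * K₁ by positivity)
    nlinarith
  have hΛ0 : 0 < Λ := by linarith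
  have hm0 : (0 : ℝ) ≤ m := by positivity
  have hmΛ : m * Real.log K₂ ≤ 8193 * (l : ℝ) ^ 3 * (K₁ * Λ) := by
    calc m * Real.log K₂ ≤ 8193 * (l : ℝ) ^ 3 * K₁ * Λ :=
          mul_le_mul hm hΛK (Real.log_nonneg hK₂) (by positivity)
      _ = _ := by ring
  set X := K₁ * Λ with hX
  have hΛX : Λ ≤ X := by nlinarith
  have hX0 : 0 < X := by positivity
  calc Real.log 2 + m * Real.log K₂ + l * (((5 : ℕ) : ℝ) * Real.log K₂ + Real.log K₁ +
        (Real.log 2 + m * Real.log K₂))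
      ≤ X + 8193 * (l : ℝ) ^ 3 * X + l * (((5 : ℕ) : ℝ) * X + 2 * X +
        (X + 8193 * (l : ℝ) ^ 3 * X)) := by gcongr <;> linarith
    _ = (1 + 8193 * (l : ℝ) ^ 3 + 8 * l + 8193 * l ^ 4) * X := by push_cast; ring
    _ < 20000 * (l : ℝ) ^ 4 * X := by
        gcongr
        linarith

theorem mainTheorem9 :
    ∃ c : ℝ, 0 < c ∧
      ∀ (G : Type*) [AddCommGroup G] [Nontrivial G] [DecidableEq G] (A B : Finset G) (K₁ K₂ : ℝ),
        A.Nonempty → B.Nonempty →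
        ((A + B).card : ℝ) ≤ K₁ * (A.card : ℝ) →
        ((A + B).card : ℝ) ≤ K₂ * (B.card : ℝ) →
        ∃ (k : ℕ) (P : Set G),
          IsArithProgOfLength P k ∧ P ⊆ ((A + B : Finset G) : Set G) ∧
          (1 / 2 : ℝ) * Real.exp
            (c * (Real.log (A.card : ℝ) / (K₁ * Real.log (2 * K₂))) ^ (1 / 4 : ℝ)) ≤ (k : ℝ) := by
  refine ⟨Real.log 2 * (1 / 20000) ^ (1 / 4 : ℝ), by positivity, ?_⟩
  intro G _ _ _ A B K₁ K₂ hA hB hAB₁ hAB₂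
  have hA0 : (0 : ℝ) < A.card := by exact_mod_cast hA.card_pos
  have hB0 : (0 : ℝ) < B.card := by exact_mod_cast hB.card_pos
  have hK₁ : 1 ≤ K₁ := by
    have h : (A.card : ℝ) ≤ (A + B).card := by exact_mod_cast Finset.card_le_card_add_right hB
    exact le_of_mul_le_mul_right (by linarith) hA0
  have hK₂ : 1 ≤ K₂ := by
    have h : (B.card : ℝ) ≤ (A + B).card := by exact_mod_cast Finset.card_le_card_add_left hA
    exact le_of_mul_le_mul_right (by linarith) hB0
  have hX : 0 < K₁ * Real.log (2 * K₂) := mul_pos (by linarith) (Real.log_pos (by linarith))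
  set L := Real.log (A.card : ℝ) / (K₁ * Real.log (2 * K₂)) with hL
  have hL0 : 0 ≤ L := div_nonneg (Real.log_natCast_nonneg _) hX.le
  set y : ℝ := (1 / 20000 * L) ^ (1 / 4 : ℝ) with hy
  have hy0 : 0 ≤ y := by positivity
  -- The factor `1/2` pays for rounding `y` down: `2^y ≤ 2 · 2^⌊y⌋`.
  have hexp : (1 / 2 : ℝ) * Real.exp (Real.log 2 * (1 / 20000) ^ (1 / 4 : ℝ) * L ^ (1 / 4 : ℝ)) ≤
      ((2 ^ ⌊y⌋₊ : ℕ) : ℝ) := by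
    rw [mul_assoc, ← Real.mul_rpow (by norm_num) hL0, ← hy, ← Real.rpow_def_of_pos (by norm_num)]
    have h1 : (2 : ℝ) ^ y ≤ 2 ^ ((⌊y⌋₊ : ℝ) + 1) :=
      Real.rpow_le_rpow_of_exponent_le (by norm_num) (Nat.lt_floor_add_one y).le
    rw [Real.rpow_add_one (by norm_num), Real.rpow_natCast] at h1
    push_cast
    linarith
  obtain ⟨a, d, hd, had⟩ : ∃ a d : G, d ≠ 0 ∧ ∀ j < 2 ^ ⌊y⌋₊, a + j • d ∈ A + B := by
    -- When `⌊y⌋ = 0`, one point of `A + B` with any non-zero step suffices.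
    rcases Nat.eq_zero_or_pos ⌊y⌋₊ with h0 | hpos
    · obtain ⟨d, hd⟩ := exists_ne (0 : G)
      obtain ⟨a, ha⟩ := hA.add hB
      refine ⟨a, d, hd, fun j hj => ?_⟩
      obtain rfl : j = 0 := by simpa [h0] using hj
      simpa using ha
    · refine exists_two_pow_progression_of_log_le hA hB hK₁ hK₂ hAB₁ hAB₂ hpos ?_
      have h4 : (⌊y⌋₊ : ℝ) ^ 4 ≤ 1 / 20000 * L := by
        calc (⌊y⌋₊ : ℝ) ^ 4 ≤ y ^ 4 := by gcongr; exact Nat.floor_le hy0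
          _ = 1 / 20000 * L := by
            rw [hy, ← Real.rpow_natCast, ← Real.rpow_mul (by positivity)]
            norm_num
      rw [← le_div_iff₀ hX, ← hL]
      linarith
  exact ⟨2 ^ ⌊y⌋₊, {x | ∃ i : ℕ, i < 2 ^ ⌊y⌋₊ ∧ x = a + i • d}, ⟨a, d, hd, rfl⟩,
    by rintro x ⟨i, hi, rfl⟩; exact had i hi, hexp⟩
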